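/- Let $n$ be a nonnegative integer, let $|\cdot|$ be the Euclidean norm on $\mathbb{R}^n$, and let $\mathbb{B} = \{v \in \mathbb{R}^n : |v| \le 1\}$. For a set-valued map $F : \mathbb{R}^n \rightrightarrows \mathbb{R}^n$ (assigning to each $x \in \mathbb{R}^n$ a subset $F(x) \subset \mathbb{R}^n$) and $D \subset \mathbb{R}^n$, write $F(D) := \bigcup_{x \in D} F(x)$, and let $\operatorname{co}$ denote the convex hull. The map $F$ is called upper semicontinuous at $x$ if for every $r > 0$ there is a neighborhood $U$ of $x$ such that $F(y) \subset F(x) + r\mathbb{B}$ for all $y \in U$. It is called lower semicontinuous at $x$ if for every $y \in F(x)$ and every sequence $(x_i)_{i \in \mathbb{N}}$ in $\mathbb{R}^n$ converging to $x$ there is a sequence $(y_i)_{i \in \mathbb{N}}$ converging to $y$ with $y_i \in F(x_i)$ for all $i$. It is called upper semicontinuous if it is so at every point, and continuous if it is both upper and lower semicontinuous at every point. Let $F : \mathbb{R}^n \rightrightarrows \mathbb{R}^n$ be upper semicontinuous and such that $F(x)$ is nonempty, compact and convex for all $x \in \mathbb{R}^n$. Then, for each continuous function $\varepsilon : \mathbb{R}^n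 \to \mathbb{R}_{>0}$, there exists a continuous set-valued map $G : \mathbb{R}^n \rightrightarrows \mathbb{R}^n$ such that $G(x)$ is convex and compact for all $x \in \mathbb{R}^n$ and $$F(x) \subset G(x) \subset \operatorname{co}\{F(x + \varepsilon(x)\mathbb{B})\} + \varepsilon(x)\mathbb{B} \qquad \text{for all } x \in \mathbb{R}^n.$$ -/

import Mathlib

open Filter Topology
open scoped Pointwise

namespace SetValuedMap

/-- The closed unit ball of `ℝⁿ` (Euclidean norm) centered at the origin. -/
def unitBall (n : ℕ) : Set (EuclideanSpace ℝ (Fin n)) :=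
  Metric.closedBall 0 1

/-- The image `F(D) = ⋃_{x ∈ D} F(x)` of a set `D` under a set-valued map `F : ℝᵐ ⇉ ℝⁿ`. -/
def image {m n : ℕ} (F : EuclideanSpace ℝ (Fin m) → Set (EuclideanSpace ℝ (Fin n)))
    (D : Set (EuclideanSpace ℝ (Fin m))) : Set (EuclideanSpace ℝ (Fin n)) :=
  ⋃ x ∈ D, F x

/-- `F` is upper semicontinuous at `x`: for each `r > 0`, all `y` in some neighborhood of `x`
satisfy `F(y) ⊆ F(x) + r𝔹`. -/
def IsUpperSemicontinuousAt {m n : ℕ}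
    (F : EuclideanSpace ℝ (Fin m) → Set (EuclideanSpace ℝ (Fin n)))
    (x : EuclideanSpace ℝ (Fin m)) : Prop :=
  ∀ r : ℝ, 0 < r → ∃ U ∈ 𝓝 x, ∀ y ∈ U, F y ⊆ F x + r • unitBall n

/-- `F` is lower semicontinuous at `x`: for each `y ∈ F(x)` and each sequence `xᵢ → x`, there is
a sequence `yᵢ ∈ F(xᵢ)` with `yᵢ → y`. -/
def IsLowerSemicontinuousAt {m n : ℕ}
    (F : EuclideanSpace ℝ (Fin m) → Set (EuclideanSpace ℝ (Fin n)))
    (x : EuclideanSpace ℝ (Fin m)) : Prop :=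
  ∀ y ∈ F x, ∀ u : ℕ → EuclideanSpace ℝ (Fin m), Tendsto u atTop (𝓝 x) →
    ∃ v : ℕ → EuclideanSpace ℝ (Fin n), (∀ i, v i ∈ F (u i)) ∧ Tendsto v atTop (𝓝 y)

/-- `F` is upper semicontinuous (at every point). -/
def IsUpperSemicontinuous {m n : ℕ}
    (F : EuclideanSpace ℝ (Fin m) → Set (EuclideanSpace ℝ (Fin n))) : Prop :=
  ∀ x, IsUpperSemicontinuousAt F x

/-- `F` is continuous: both upper and lower semicontinuous at every point. -/
def IsContinuous {m n : ℕ}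
    (F : EuclideanSpace ℝ (Fin m) → Set (EuclideanSpace ℝ (Fin n))) : Prop :=
  ∀ x, IsUpperSemicontinuousAt F x ∧ IsLowerSemicontinuousAt F x

end SetValuedMap

/-!
Upper semicontinuity gives every point `z` a neighborhood `U z` on which `F` takes values in the
compact convex set `C z = F z + (ε z / 2) 𝔹`; after shrinking, every `x ∈ U z` satisfies
`dist z x ≤ ε x` and `ε z / 2 ≤ ε x`. For a partition of unity `φ` subordinate to `U`, put
`G x = ∑ z, φ z x • C z`.

* If `φ z x ≠ 0`, then `F x ⊆ C z ⊆ F (x + ε x 𝔹) + ε x 𝔹`. Averaging over `z` gives both required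
  inclusions, since `F x ⊆ C z` lets `y ∈ F x` be written as `∑ z, φ z x • y`.
* `G x` is the image of the fixed set `∏ z, C z`, which is compact by Tychonoff's theorem, under
  `c ↦ ∑ z, φ z x • c z`. This expression is linear in `c` and, by local finiteness, jointly
  continuous in `(x, c)`. A family of images of one compact set under a jointly continuous map is
  continuous (`SetValuedMap.isContinuous_image_of_isCompact`).
-/

namespace SetValuedMap

theorem smul_unitBall {n : ℕ} {r : ℝ} (hr : 0 ≤ r) :
    r • unitBall n = Metric.closedBall 0 r := by
  rw [unitBall, smul_unitClosedBall_of_nonneg hr]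

/-- The images of a fixed compact set under a jointly continuous family of maps form a continuous
set-valued map. Upper semicontinuity is the tube lemma; for lower semicontinuity, the parameter
`c ∈ K` of a point of the image is kept fixed along the sequence. -/
theorem isContinuous_image_of_isCompact {m n : ℕ} {P : Type*} [TopologicalSpace P]
    {Φ : EuclideanSpace ℝ (Fin m) → P → EuclideanSpace ℝ (Fin n)}
    (hΦ : Continuous fun p : EuclideanSpace ℝ (Fin m) × P ↦ Φ p.1 p.2)
    {K : Set P} (hK : IsCompact K) :
    IsContinuous fun x ↦ Φ x '' K := by
  refine fun x ↦ ⟨fun r hr ↦ ?_, ?_⟩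
  · have h : ∀ᶠ y in 𝓝 x, ∀ c ∈ K, dist (Φ y c) (Φ x c) < r := by
      refine hK.eventually_forall_of_forall_eventually fun c _ ↦ ?_
      have hcont : Continuous fun p : EuclideanSpace ℝ (Fin m) × P ↦
          dist (Φ p.1 p.2) (Φ x p.2) :=
        hΦ.dist (hΦ.comp (continuous_const.prodMk continuous_snd))
      exact hcont.continuousAt.eventually_lt continuousAt_const (by simpa using hr)
    refine ⟨_, h, ?_⟩
    rintro y hy _ ⟨c, hc, rfl⟩
    rw [smul_unitBall hr.le]
    refine ⟨Φ x c, ⟨c, hc, rfl⟩, Φ y c - Φ x c, ?_, by simp⟩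
    simpa [dist_eq_norm] using (hy c hc).le
  · rintro _ ⟨c, hc, rfl⟩ u hu
    have hcont : Continuous fun y ↦ Φ y c := hΦ.comp (continuous_id.prodMk continuous_const)
    exact ⟨fun i ↦ Φ (u i) c, fun i ↦ ⟨c, hc, rfl⟩, (hcont.tendsto x).comp hu⟩

end SetValuedMap

namespace PartitionOfUnity

variable {ι X E : Type*} [TopologicalSpace X] [AddCommGroup E] [Module ℝ E]
  {s : Set X} (φ : PartitionOfUnity ι X s)

theorem finite_support_smul (x : X) (c : ι → E) :
    (Function.support fun i ↦ φ i x • c i).Finite :=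
  (φ.locallyFinite.point_finite x).subset fun _ hi ↦ left_ne_zero_of_smul hi

theorem continuous_finsum_smul_pi [TopologicalSpace E] [ContinuousAdd E] [ContinuousSMul ℝ E] :
    Continuous fun p : X × (ι → E) ↦ ∑ᶠ i, φ i p.1 • p.2 i := by
  refine continuous_finsum (fun i ↦ by fun_prop) ?_
  exact (φ.locallyFinite.preimage_continuous continuous_fst).subset
    fun i _ hp ↦ left_ne_zero_of_smul hp

theorem convex_image_finsum_smul (x : X) {K : Set (ι → E)} (hK : Convex ℝ K) :
    Convex ℝ ((fun c : ι → E ↦ ∑ᶠ i, φ i x • c i) '' K) := by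
  refine hK.is_linear_image ⟨fun c d ↦ ?_, fun a c ↦ ?_⟩
  · simp only [Pi.add_apply, smul_add]
    exact finsum_add_distrib (φ.finite_support_smul x c) (φ.finite_support_smul x d)
  · simp only [Pi.smul_apply, smul_comm _ a]
    exact (smul_finsum a _).symm

/-- A point lying in every `C i` with `φ i x ≠ 0` is the average of a selection of `C`. The
nonemptiness of the other sets is needed to complete the selection. -/
theorem mem_image_finsum_smul {x : X} (hx : x ∈ s) {C : ι → Set E} (hC : ∀ i, (C i).Nonempty)
    {y : E} (hy : ∀ i, φ i x ≠ 0 → y ∈ C i) :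
    y ∈ (fun c : ι → E ↦ ∑ᶠ i, φ i x • c i) '' Set.univ.pi C := by
  classical
  choose d hd using hC
  refine ⟨fun i ↦ if φ i x = 0 then d i else y, fun i _ ↦ ?_, ?_⟩
  · by_cases h : φ i x = 0
    · simpa [h] using hd i
    · simpa [h] using hy i h
  · have h : ∀ i, φ i x • (if φ i x = 0 then d i else y) = φ i x • y := fun i ↦ by
      split_ifs with h <;> simp [h]
    simp only [h]
    rw [← finsum_smul, φ.sum_eq_one hx, one_smul]

end PartitionOfUnity

theorem proposition1 (n : ℕ)
    (F : EuclideanSpace ℝ (Fin n) → Set (EuclideanSpace ℝ (Fin n)))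
    (hF_usc : SetValuedMap.IsUpperSemicontinuous F)
    (hF_nonempty : ∀ x, (F x).Nonempty)
    (hF_compact : ∀ x, IsCompact (F x))
    (hF_convex : ∀ x, Convex ℝ (F x))
    (ε : EuclideanSpace ℝ (Fin n) → ℝ)
    (hε_cont : Continuous ε)
    (hε_pos : ∀ x, 0 < ε x) :
    ∃ G : EuclideanSpace ℝ (Fin n) → Set (EuclideanSpace ℝ (Fin n)),
      SetValuedMap.IsContinuous G ∧
      (∀ x, Convex ℝ (G x)) ∧
      (∀ x, IsCompact (G x)) ∧
      ∀ x, F x ⊆ G x ∧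
        G x ⊆ convexHull ℝ
            (SetValuedMap.image F ({x} + ε x • SetValuedMap.unitBall n)) +
          ε x • SetValuedMap.unitBall n := by
  have hhalf (z) : 0 < ε z / 2 := half_pos (hε_pos z)
  let C (z : EuclideanSpace ℝ (Fin n)) : Set (EuclideanSpace ℝ (Fin n)) :=
    F z + Metric.closedBall 0 (ε z / 2)
  have hC_compact (z) : IsCompact (C z) := (hF_compact z).add (isCompact_closedBall _ _)
  have hC_convex (z) : Convex ℝ (C z) := (hF_convex z).add (convex_closedBall _ _)
  have hC_nonempty (z) : (C z).Nonempty :=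
    (hF_nonempty z).add (Metric.nonempty_closedBall.2 (hhalf z).le)
  have hU (z) : ∃ U : Set (EuclideanSpace ℝ (Fin n)), IsOpen U ∧ z ∈ U ∧
      ∀ x ∈ U, F x ⊆ C z ∧ ε z / 2 < ε x ∧ dist x z < ε z / 2 := by
    obtain ⟨V, hV, hFV⟩ := hF_usc z _ (hhalf z)
    rw [SetValuedMap.smul_unitBall (hhalf z).le] at hFV
    have hev : ∀ᶠ x in 𝓝 z, F x ⊆ C z ∧ ε z / 2 < ε x ∧ dist x z < ε z / 2 :=
      (eventually_of_mem hV hFV).and <|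
        (continuousAt_const.eventually_lt hε_cont.continuousAt (half_lt_self (hε_pos z))).and
          (Metric.ball_mem_nhds z (hhalf z))
    obtain ⟨U, hUsub, hUo, hzU⟩ := eventually_nhds_iff.1 hev
    exact ⟨U, hUo, hzU, hUsub⟩
  choose U hUo hzU hUsub using hU
  obtain ⟨φ, hφ⟩ := PartitionOfUnity.exists_isSubordinate isClosed_univ U hUo
    fun z _ ↦ Set.mem_iUnion.2 ⟨z, hzU z⟩
  have hmem {x z} (h : φ z x ≠ 0) : x ∈ U z := hφ z (subset_tsupport _ h)
  have hK : IsCompact (Set.univ.pi C) := isCompact_univ_pi hC_compact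
  have hcont := φ.continuous_finsum_smul_pi (E := EuclideanSpace ℝ (Fin n))
  refine ⟨fun x ↦ (fun c : EuclideanSpace ℝ (Fin n) → EuclideanSpace ℝ (Fin n) ↦
      ∑ᶠ z, φ z x • c z) '' Set.univ.pi C,
    SetValuedMap.isContinuous_image_of_isCompact hcont hK,
    fun x ↦ φ.convex_image_finsum_smul x (convex_pi fun z _ ↦ hC_convex z),
    fun x ↦ hK.image (hcont.comp (Continuous.prodMk_right x)),
    fun x ↦ ⟨fun y hy ↦ ?_, ?_⟩⟩
  · exact φ.mem_image_finsum_smul (Set.mem_univ x) hC_nonempty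
      fun z hz ↦ (hUsub z x (hmem hz)).1 hy
  · rintro _ ⟨c, hc, rfl⟩
    rw [SetValuedMap.smul_unitBall (hε_pos x).le]
    refine φ.finsum_smul_mem_convex (g := fun z _ ↦ c z) (Set.mem_univ x) (fun z hz ↦ ?_)
      ((convex_convexHull ℝ _).add (convex_closedBall _ _))
    obtain ⟨-, hεz, hdist⟩ := hUsub z x (hmem hz)
    refine Set.add_subset_add (fun w hw ↦ subset_convexHull ℝ _ ?_)
      (Metric.closedBall_subset_closedBall hεz.le) (hc z (Set.mem_univ z))
    refine Set.mem_biUnion (x := z) ?_ hw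
    rw [singleton_add_closedBall, add_zero, Metric.mem_closedBall, dist_comm]
    exact (hdist.trans hεz).le
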